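/- Let $\mathbb F$ be an algebraically closed field of characteristic different from $2$ and $3$. A Lie superalgebra over $\mathbb F$ is a vector space $L=L_0\oplus L_1$ (graded by $\mathbb Z/2$) with a bilinear bracket such that $[L_a,L_b]\subseteq L_{a+b}$, $[x,y]=-(-1)^{|x||y|}[y,x]$ and $$(-1)^{|x||z|}[x,[y,z]]+(-1)^{|y||x|}[y,[z,x]]+(-1)^{|z||y|}[z,[x,y]]=0$$ for homogeneous $x,y,z$. A pair of Lie superalgebras $(N,L)$ consists of a Lie superalgebra $L$ and a graded ideal $N$ of $L$. Given a free presentation $0\to R\to F\to L\to 0$ of $L$ (with $F$ a free Lie superalgebra on a $\mathbb Z/2$-graded set) and the ideal $S\supseteq R$ of $F$ with $S/R\cong N$, the Schur multiplier of the pair is $$\mathcal M(N,L)=\frac{R\cap[S,F]}{[R,F]}.$$ **Theorem.** Let $(N,L)$ be a pair of Lie superalgebras with $L$ finite dimensional, and put $m=\dim N_0$, $n=\dim N_1$, where $N_a=N\cap L_a$. Then, for every free presentation of $L$, the space $\mathcal M(N,L)$ is finite dimensional and $$\dim\mathcal M(N,L)\le \tfrac12\bigl((m+n)^2+(n-m)\bigr)+\dim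 N\cdot\dim(L/N).$$ If $L$ is abelian (that is, $[L,L]=0$), then equality holds; and if equality holds, then $N\subseteq Z(L)=\{z\in L : [z,x]=0 \text{ for all } x\in L\}$. -/

import Mathlib

noncomputable section

namespace LieSuper

universe u v w

/-! ### Superspaces and Lie superalgebras -/

/-- `V 0` and `V 1` being the even and the odd part of a superspace, the subspace `U` is a
sub-superspace: `U = (U ∩ V 0) ⊕ (U ∩ V 1)`. -/
def IsSubsuperspace {𝕜 : Type u} {E : Type v} [Field 𝕜] [AddCommGroup E] [Module 𝕜 E]
    (V : ZMod 2 → Submodule 𝕜 E) (U : Submodule 𝕜 E) : Prop :=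
  U = (U ⊓ V 0) ⊔ (U ⊓ V 1)

/-- A Lie superalgebra over `𝕜` on the vector space `L` with bracket `⁅·, ·⁆`: the bracket is
bilinear, `L = part 0 ⊕ part 1`, the bracket is even, and the graded antisymmetry and the graded
Jacobi identity hold for homogeneous elements. -/
class LieSuperalgebra (𝕜 : Type u) (L : Type v) [Field 𝕜] [AddCommGroup L] [Module 𝕜 L]
    [Bracket L L] where
  /-- The homogeneous parts: `part 0` is the even part and `part 1` the odd part. -/
  part : ZMod 2 → Submodule 𝕜 L
  isCompl_part : IsCompl (part 0) (part 1)
  add_bracket : ∀ x y z : L, ⁅x + y, z⁆ = ⁅x, z⁆ + ⁅y, z⁆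
  bracket_add : ∀ x y z : L, ⁅x, y + z⁆ = ⁅x, y⁆ + ⁅x, z⁆
  smul_bracket : ∀ (c : 𝕜) (x y : L), ⁅c • x, y⁆ = c • ⁅x, y⁆
  bracket_smul : ∀ (c : 𝕜) (x y : L), ⁅x, c • y⁆ = c • ⁅x, y⁆
  bracket_mem : ∀ (a b : ZMod 2) (x y : L), x ∈ part a → y ∈ part b → ⁅x, y⁆ ∈ part (a + b)
  antisymm : ∀ (a b : ZMod 2) (x y : L), x ∈ part a → y ∈ part b →
    ⁅x, y⁆ = -((-1 : 𝕜) ^ (a.val * b.val) • ⁅y, x⁆)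
  jacobi : ∀ (a b c : ZMod 2) (x y z : L), x ∈ part a → y ∈ part b → z ∈ part c →
    (-1 : 𝕜) ^ (a.val * c.val) • ⁅x, ⁅y, z⁆⁆ + (-1 : 𝕜) ^ (b.val * a.val) • ⁅y, ⁅z, x⁆⁆
      + (-1 : 𝕜) ^ (c.val * b.val) • ⁅z, ⁅x, y⁆⁆ = 0

section basic

variable (𝕜 : Type u) {L : Type v} [Field 𝕜] [AddCommGroup L] [Module 𝕜 L] [Bracket L L]
  [LieSuperalgebra 𝕜 L]

/-- `N` is a graded ideal of `L`, that is, `(N, L)` is a pair of Lie superalgebras. -/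
structure IsGradedIdeal (N : Submodule 𝕜 L) : Prop where
  graded : IsSubsuperspace (LieSuperalgebra.part (𝕜 := 𝕜) (L := L)) N
  bracket_mem : ∀ x ∈ N, ∀ y : L, ⁅x, y⁆ ∈ N

/-- `[A, B]`: the subspace spanned by all `⁅a, b⁆` with `a ∈ A` and `b ∈ B`. -/
def commutator (A B : Submodule 𝕜 L) : Submodule 𝕜 L :=
  Submodule.span 𝕜 {z | ∃ a ∈ A, ∃ b ∈ B, ⁅a, b⁆ = z}

variable (L) in
/-- The center `Z(L) = {z | ⁅z, x⁆ = 0 for all x}`. -/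
def center : Submodule 𝕜 L where
  carrier := {z | ∀ x : L, ⁅z, x⁆ = 0}
  zero_mem' x := by
    have h := LieSuperalgebra.smul_bracket (0 : 𝕜) (0 : L) x
    simpa using h
  add_mem' {a b} ha hb x := by
    rw [LieSuperalgebra.add_bracket (𝕜 := 𝕜), ha x, hb x, add_zero]
  smul_mem' c a ha x := by
    rw [LieSuperalgebra.smul_bracket, ha x, smul_zero]

/-- `L` is abelian. -/
def IsAbelian (L : Type v) [AddCommGroup L] [Bracket L L] : Prop :=
  ∀ x y : L, ⁅x, y⁆ = 0

/-- A homomorphism of Lie superalgebras: an even linear map that preserves brackets. -/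
structure IsSuperHom {K : Type w} [AddCommGroup K] [Module 𝕜 K] [Bracket K K]
    [LieSuperalgebra 𝕜 K] (f : K →ₗ[𝕜] L) : Prop where
  map_part : ∀ (a : ZMod 2) (x : K), x ∈ LieSuperalgebra.part (𝕜 := 𝕜) (L := K) a →
    f x ∈ LieSuperalgebra.part (𝕜 := 𝕜) (L := L) a
  map_bracket : ∀ x y : K, f ⁅x, y⁆ = ⁅f x, f y⁆

end basic

/-! ### The free Lie superalgebra on a `ℤ/2`-graded set

`X` is the set of generators and `deg : X → ZMod 2` gives their degrees. The free Lie superalgebra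
is the quotient of the free non-associative algebra on `X` by the smallest graded two-sided ideal
that contains the graded antisymmetry and the graded Jacobi relations. -/

section free

variable (𝕜 : Type u) [Field 𝕜] {X : Type w} (deg : X → ZMod 2)

/-- The degree of a non-associative monomial: the sum of the degrees of its letters. -/
def wordDeg : FreeMagma X → ZMod 2
  | FreeMagma.of x => deg x
  | FreeMagma.mul a b => wordDeg a + wordDeg b

/-- The homogeneous parts of the free non-associative algebra. -/
def freePart (a : ZMod 2) : Submodule 𝕜 (FreeNonUnitalNonAssocAlgebra 𝕜 X) where
  carrier := {f | ∀ m, f.coeff m ≠ 0 → wordDeg deg m = a}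
  zero_mem' m hm := by simp at hm
  add_mem' {f g} hf hg m hm := by
    by_cases h : f.coeff m = 0
    · exact hg m fun h' => hm (by simp [h, h'])
    · exact hf m h
  smul_mem' c f hf m hm := hf m fun h => hm (by simp [h])

/-- `J` is a graded two-sided ideal of the free non-associative algebra that contains all the
defining relations of a Lie superalgebra. -/
structure IsRelationIdeal (J : Submodule 𝕜 (FreeNonUnitalNonAssocAlgebra 𝕜 X)) : Prop where
  graded : IsSubsuperspace (freePart 𝕜 deg) J
  mul_left : ∀ f, ∀ g ∈ J, f * g ∈ J
  mul_right : ∀ f, ∀ g ∈ J, g * f ∈ J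
  antisymm : ∀ (a b : ZMod 2) (x y : FreeNonUnitalNonAssocAlgebra 𝕜 X),
    x ∈ freePart 𝕜 deg a → y ∈ freePart 𝕜 deg b →
    x * y + (-1 : 𝕜) ^ (a.val * b.val) • (y * x) ∈ J
  jacobi : ∀ (a b c : ZMod 2) (x y z : FreeNonUnitalNonAssocAlgebra 𝕜 X),
    x ∈ freePart 𝕜 deg a → y ∈ freePart 𝕜 deg b → z ∈ freePart 𝕜 deg c →
    (-1 : 𝕜) ^ (a.val * c.val) • (x * (y * z)) + (-1 : 𝕜) ^ (b.val * a.val) • (y * (z * x))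
      + (-1 : 𝕜) ^ (c.val * b.val) • (z * (x * y)) ∈ J

/-- The smallest graded two-sided ideal that contains the defining relations. -/
def relationIdeal : Submodule 𝕜 (FreeNonUnitalNonAssocAlgebra 𝕜 X) :=
  sInf {J | IsRelationIdeal 𝕜 deg J}

theorem isCompl_freePart : IsCompl (freePart 𝕜 deg 0) (freePart 𝕜 deg 1) := by
  classical
  constructor
  · rw [Submodule.disjoint_def]
    intro f h0 h1
    refine MonoidAlgebra.coeff_injective (Finsupp.ext fun m => ?_)
    by_contra h
    exact absurd ((h0 m h).symm.trans (h1 m h)) (by decide)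
  · rw [codisjoint_iff, eq_top_iff]
    intro f _
    induction f using MonoidAlgebra.induction_linear with
    | zero => exact Submodule.zero_mem _
    | add f g hf hg => exact Submodule.add_mem _ (hf trivial) (hg trivial)
    | single m r =>
      have key : ∀ a, wordDeg deg m = a →
          (MonoidAlgebra.single m r : FreeNonUnitalNonAssocAlgebra 𝕜 X) ∈ freePart 𝕜 deg a := by
        intro a ha m' hm'
        rw [MonoidAlgebra.coeff_single, Finsupp.single_apply] at hm'
        by_cases h : m = m'
        · rw [← h, ha]
        · simp [h] at hm'
      have h2 : ∀ a : ZMod 2, a = 0 ∨ a = 1 := by decide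
      rcases h2 (wordDeg deg m) with h | h
      · exact Submodule.mem_sup_left (key _ h)
      · exact Submodule.mem_sup_right (key _ h)

theorem mul_mem_freePart (a b : ZMod 2) (x y : FreeNonUnitalNonAssocAlgebra 𝕜 X)
    (hx : x ∈ freePart 𝕜 deg a) (hy : y ∈ freePart 𝕜 deg b) :
    x * y ∈ freePart 𝕜 deg (a + b) := by
  classical
  intro m hm
  rw [MonoidAlgebra.coeff_mul] at hm
  obtain ⟨p, hp, hp'⟩ := Finset.exists_ne_zero_of_sum_ne_zero hm
  obtain ⟨q, hq, hq'⟩ := Finset.exists_ne_zero_of_sum_ne_zero hp'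
  have hpq : p * q = m := by
    by_contra h
    simp [h] at hq'
  rw [← hpq, ← hx p (Finsupp.mem_support_iff.1 hp), ← hy q (Finsupp.mem_support_iff.1 hq)]
  rfl

theorem isSubsuperspace_iff {E : Type v} [AddCommGroup E] [Module 𝕜 E]
    {V : ZMod 2 → Submodule 𝕜 E} (hV : IsCompl (V 0) (V 1)) (U : Submodule 𝕜 E) :
    IsSubsuperspace V U ↔ ∀ x ∈ V 0, ∀ y ∈ V 1, x + y ∈ U → x ∈ U ∧ y ∈ U := by
  constructor
  · intro h x hx y hy hxy
    rw [h] at hxy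
    obtain ⟨x', hx', y', hy', e⟩ := Submodule.mem_sup.1 hxy
    have e1 : x - x' = y' - y := by
      rw [sub_eq_sub_iff_add_eq_add, add_comm y' x', e]
    have h0 : x - x' = 0 := Submodule.disjoint_def.1 hV.disjoint _
      (Submodule.sub_mem _ hx hx'.2) (e1 ▸ Submodule.sub_mem _ hy'.2 hy)
    rw [h0] at e1
    rw [sub_eq_zero.1 h0, ← sub_eq_zero.1 e1.symm]
    exact ⟨hx'.1, hy'.1⟩
  · intro h
    refine le_antisymm (fun z hz => ?_) (sup_le inf_le_left inf_le_left)
    have hz' : z ∈ V 0 ⊔ V 1 := by rw [hV.sup_eq_top]; trivial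
    obtain ⟨x, hx, y, hy, rfl⟩ := Submodule.mem_sup.1 hz'
    obtain ⟨h1, h2⟩ := h x hx y hy hz
    exact Submodule.mem_sup.2 ⟨x, ⟨h1, hx⟩, y, ⟨h2, hy⟩, rfl⟩

theorem isRelationIdeal_relationIdeal : IsRelationIdeal 𝕜 deg (relationIdeal 𝕜 deg) where
  graded := by
    refine (isSubsuperspace_iff 𝕜 (isCompl_freePart 𝕜 deg) _).2 fun x hx y hy hxy => ?_
    have h : ∀ J, IsRelationIdeal 𝕜 deg J → x ∈ J ∧ y ∈ J := fun J hJ =>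
      (isSubsuperspace_iff 𝕜 (isCompl_freePart 𝕜 deg) _).1 hJ.graded x hx y hy
        ((Submodule.mem_sInf.1 hxy) J hJ)
    exact ⟨Submodule.mem_sInf.2 fun J hJ => (h J hJ).1, Submodule.mem_sInf.2 fun J hJ => (h J hJ).2⟩
  mul_left f g hg := Submodule.mem_sInf.2 fun J hJ =>
    hJ.mul_left f g ((Submodule.mem_sInf.1 hg) J hJ)
  mul_right f g hg := Submodule.mem_sInf.2 fun J hJ =>
    hJ.mul_right f g ((Submodule.mem_sInf.1 hg) J hJ)
  antisymm a b x y hx hy := Submodule.mem_sInf.2 fun _ hJ => hJ.antisymm a b x y hx hy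
  jacobi a b c x y z hx hy hz := Submodule.mem_sInf.2 fun _ hJ => hJ.jacobi a b c x y z hx hy hz

/-- The free Lie superalgebra over `𝕜` on the `ℤ/2`-graded set `(X, deg)`. -/
def FreeLieSuperalgebra : Type (max u w) :=
  FreeNonUnitalNonAssocAlgebra 𝕜 X ⧸ relationIdeal 𝕜 deg

namespace FreeLieSuperalgebra

instance : AddCommGroup (FreeLieSuperalgebra 𝕜 deg) :=
  inferInstanceAs (AddCommGroup (FreeNonUnitalNonAssocAlgebra 𝕜 X ⧸ relationIdeal 𝕜 deg))

instance : Module 𝕜 (FreeLieSuperalgebra 𝕜 deg) :=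
  inferInstanceAs (Module 𝕜 (FreeNonUnitalNonAssocAlgebra 𝕜 X ⧸ relationIdeal 𝕜 deg))

/-- The quotient map from the free non-associative algebra. -/
def mk : FreeNonUnitalNonAssocAlgebra 𝕜 X →ₗ[𝕜] FreeLieSuperalgebra 𝕜 deg :=
  (relationIdeal 𝕜 deg).mkQ

/-- The generators. -/
def of (x : X) : FreeLieSuperalgebra 𝕜 deg :=
  mk 𝕜 deg (FreeNonUnitalNonAssocAlgebra.of 𝕜 x)

theorem mk_surjective : Function.Surjective (mk 𝕜 deg) :=
  Submodule.mkQ_surjective _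

theorem mk_eq_zero {f : FreeNonUnitalNonAssocAlgebra 𝕜 X} :
    mk 𝕜 deg f = 0 ↔ f ∈ relationIdeal 𝕜 deg :=
  Submodule.Quotient.mk_eq_zero _

/-- The bracket is induced by the multiplication of the free non-associative algebra. -/
instance : Bracket (FreeLieSuperalgebra 𝕜 deg) (FreeLieSuperalgebra 𝕜 deg) where
  bracket := Quotient.map₂ (fun f g => f * g) (by
    intro f f' hf g g' hg
    have hI := isRelationIdeal_relationIdeal 𝕜 deg
    replace hf := (Submodule.quotientRel_def _).1 hf
    replace hg := (Submodule.quotientRel_def _).1 hg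
    refine (Submodule.quotientRel_def _).2 ?_
    have e : f * g - f' * g' = (f - f') * g + f' * (g - g') := by
      rw [sub_mul, mul_sub]; abel
    rw [e]
    exact Submodule.add_mem _ (hI.mul_right _ _ hf) (hI.mul_left _ _ hg))

theorem mk_mul (f g : FreeNonUnitalNonAssocAlgebra 𝕜 X) :
    mk 𝕜 deg (f * g) = ⁅mk 𝕜 deg f, mk 𝕜 deg g⁆ := rfl

instance : LieSuperalgebra 𝕜 (FreeLieSuperalgebra 𝕜 deg) where
  part a := (freePart 𝕜 deg a).map (mk 𝕜 deg)
  isCompl_part := by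
    have hI := isRelationIdeal_relationIdeal 𝕜 deg
    have hc := isCompl_freePart 𝕜 deg
    constructor
    · rw [Submodule.disjoint_def]
      rintro _ ⟨f, hf, rfl⟩ ⟨g, hg, hfg⟩
      have h1 : f + -g ∈ relationIdeal 𝕜 deg := by
        rw [← mk_eq_zero, map_add, map_neg, hfg, add_neg_cancel]
      exact (mk_eq_zero 𝕜 deg).2 ((isSubsuperspace_iff 𝕜 hc _).1 hI.graded f hf (-g)
        (Submodule.neg_mem _ hg) h1).1
    · rw [codisjoint_iff, ← Submodule.map_sup, hc.sup_eq_top, Submodule.map_top,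
        LinearMap.range_eq_top]
      exact mk_surjective 𝕜 deg
  add_bracket x y z := by
    obtain ⟨x, rfl⟩ := mk_surjective 𝕜 deg x
    obtain ⟨y, rfl⟩ := mk_surjective 𝕜 deg y
    obtain ⟨z, rfl⟩ := mk_surjective 𝕜 deg z
    rw [← map_add, ← mk_mul, ← mk_mul, ← mk_mul, add_mul, map_add]
  bracket_add x y z := by
    obtain ⟨x, rfl⟩ := mk_surjective 𝕜 deg x
    obtain ⟨y, rfl⟩ := mk_surjective 𝕜 deg y
    obtain ⟨z, rfl⟩ := mk_surjective 𝕜 deg z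
    rw [← map_add, ← mk_mul, ← mk_mul, ← mk_mul, mul_add, map_add]
  smul_bracket c x y := by
    obtain ⟨x, rfl⟩ := mk_surjective 𝕜 deg x
    obtain ⟨y, rfl⟩ := mk_surjective 𝕜 deg y
    rw [← map_smul, ← mk_mul, ← mk_mul, smul_mul_assoc, map_smul]
  bracket_smul c x y := by
    obtain ⟨x, rfl⟩ := mk_surjective 𝕜 deg x
    obtain ⟨y, rfl⟩ := mk_surjective 𝕜 deg y
    rw [← map_smul, ← mk_mul, ← mk_mul, mul_smul_comm, map_smul]
  bracket_mem := by
    rintro a b _ _ ⟨f, hf, rfl⟩ ⟨g, hg, rfl⟩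
    exact ⟨f * g, mul_mem_freePart 𝕜 deg a b f g hf hg, rfl⟩
  antisymm := by
    rintro a b _ _ ⟨f, hf, rfl⟩ ⟨g, hg, rfl⟩
    have h := (mk_eq_zero 𝕜 deg).2
      ((isRelationIdeal_relationIdeal 𝕜 deg).antisymm a b f g hf hg)
    rw [map_add, map_smul, mk_mul, mk_mul] at h
    exact eq_neg_of_add_eq_zero_left h
  jacobi := by
    rintro a b c _ _ _ ⟨f, hf, rfl⟩ ⟨g, hg, rfl⟩ ⟨k, hk, rfl⟩
    have h := (mk_eq_zero 𝕜 deg).2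
      ((isRelationIdeal_relationIdeal 𝕜 deg).jacobi a b c f g k hf hg hk)
    simpa only [map_add, map_smul, mk_mul] using h

/-! #### The universal property -/

section lift

variable {𝕜 deg} {L : Type v} [AddCommGroup L] [Module 𝕜 L] [Bracket L L]

/-- Evaluation of a non-associative monomial in `L`. -/
def evalWord (φ : X → L) : FreeMagma X → L
  | FreeMagma.of x => φ x
  | FreeMagma.mul a b => ⁅evalWord φ a, evalWord φ b⁆

/-- Evaluation of a non-associative polynomial in `L`. -/
def eval (φ : X → L) : FreeNonUnitalNonAssocAlgebra 𝕜 X →ₗ[𝕜] L where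
  toFun f := Finsupp.linearCombination 𝕜 (evalWord φ) f.coeff
  map_add' f g := by rw [MonoidAlgebra.coeff_add, map_add]
  map_smul' c f := by rw [MonoidAlgebra.coeff_smul, map_smul, RingHom.id_apply]

theorem eval_single (φ : X → L) (m : FreeMagma X) (r : 𝕜) :
    eval φ (MonoidAlgebra.single m r : FreeNonUnitalNonAssocAlgebra 𝕜 X) = r • evalWord φ m := by
  change Finsupp.linearCombination 𝕜 (evalWord φ) (Finsupp.single m r) = _
  rw [Finsupp.linearCombination_single]

variable [LieSuperalgebra 𝕜 L]

theorem eval_mul (φ : X → L) (f g : FreeNonUnitalNonAssocAlgebra 𝕜 X) :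
    eval φ (f * g) = ⁅eval φ f, eval φ g⁆ := by
  have z1 : ∀ x : L, ⁅(0 : L), x⁆ = 0 := fun x => by
    simpa using LieSuperalgebra.smul_bracket (0 : 𝕜) (0 : L) x
  have z2 : ∀ x : L, ⁅x, (0 : L)⁆ = 0 := fun x => by
    simpa using LieSuperalgebra.bracket_smul (0 : 𝕜) x (0 : L)
  induction f using MonoidAlgebra.induction_linear with
  | zero => rw [zero_mul, map_zero, z1]
  | add f f' hf hf' =>
    rw [add_mul, map_add, map_add, hf, hf', LieSuperalgebra.add_bracket (𝕜 := 𝕜)]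
  | single m r =>
    induction g using MonoidAlgebra.induction_linear with
    | zero => rw [mul_zero, map_zero, z2]
    | add g g' hg hg' =>
      rw [mul_add, map_add, map_add, hg, hg', LieSuperalgebra.bracket_add (𝕜 := 𝕜)]
    | single m' r' =>
      rw [MonoidAlgebra.single_mul_single, eval_single, eval_single, eval_single,
        LieSuperalgebra.smul_bracket, LieSuperalgebra.bracket_smul, smul_smul]
      rfl

theorem eval_mem (φ : X → L) (hφ : ∀ x, φ x ∈ LieSuperalgebra.part (𝕜 := 𝕜) (deg x))
    (a : ZMod 2) (f : FreeNonUnitalNonAssocAlgebra 𝕜 X) (hf : f ∈ freePart 𝕜 deg a) :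
    eval φ f ∈ LieSuperalgebra.part (𝕜 := 𝕜) (L := L) a := by
  have hw : ∀ m : FreeMagma X,
      evalWord φ m ∈ LieSuperalgebra.part (𝕜 := 𝕜) (L := L) (wordDeg deg m) := by
    intro m
    induction m with
    | ih1 x => exact hφ x
    | ih2 p q hp hq => exact LieSuperalgebra.bracket_mem _ _ _ _ hp hq
  change Finsupp.linearCombination 𝕜 (evalWord φ) f.coeff ∈ _
  rw [Finsupp.linearCombination_apply]
  refine Submodule.sum_mem _ fun m hm => Submodule.smul_mem _ _ ?_
  rw [← hf m (Finsupp.mem_support_iff.1 hm)]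
  exact hw m

theorem isRelationIdeal_ker_eval (φ : X → L)
    (hφ : ∀ x, φ x ∈ LieSuperalgebra.part (𝕜 := 𝕜) (deg x)) :
    IsRelationIdeal 𝕜 deg (LinearMap.ker (eval (𝕜 := 𝕜) φ)) where
  graded := by
    refine (isSubsuperspace_iff 𝕜 (isCompl_freePart 𝕜 deg) _).2 fun x hx y hy hxy => ?_
    rw [LinearMap.mem_ker, map_add] at hxy
    have hx' := eval_mem φ hφ 0 x hx
    have hy' := eval_mem φ hφ 1 y hy
    have h0 : eval φ x = 0 :=
      Submodule.disjoint_def.1 (LieSuperalgebra.isCompl_part (𝕜 := 𝕜) (L := L)).disjoint _ hx'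
        (by rw [eq_neg_of_add_eq_zero_left hxy]; exact Submodule.neg_mem _ hy')
    rw [h0, zero_add] at hxy
    exact ⟨h0, hxy⟩
  mul_left f g hg := by
    rw [LinearMap.mem_ker] at hg ⊢
    rw [eval_mul, hg]
    simpa using LieSuperalgebra.bracket_smul (0 : 𝕜) (eval φ f) (0 : L)
  mul_right f g hg := by
    rw [LinearMap.mem_ker] at hg ⊢
    rw [eval_mul, hg]
    simpa using LieSuperalgebra.smul_bracket (0 : 𝕜) (0 : L) (eval φ f)
  antisymm a b x y hx hy := by
    rw [LinearMap.mem_ker, map_add, map_smul, eval_mul, eval_mul,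
      LieSuperalgebra.antisymm a b _ _ (eval_mem φ hφ a x hx) (eval_mem φ hφ b y hy),
      neg_add_cancel]
  jacobi a b c x y z hx hy hz := by
    rw [LinearMap.mem_ker]
    simp only [map_add, map_smul, eval_mul]
    exact LieSuperalgebra.jacobi a b c _ _ _ (eval_mem φ hφ a x hx) (eval_mem φ hφ b y hy)
      (eval_mem φ hφ c z hz)

/-- The extension of a degree-preserving map on the generators to the free Lie superalgebra. -/
def lift (φ : X → L) (hφ : ∀ x, φ x ∈ LieSuperalgebra.part (𝕜 := 𝕜) (deg x)) :
    FreeLieSuperalgebra 𝕜 deg →ₗ[𝕜] L :=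
  (relationIdeal 𝕜 deg).liftQ (eval φ) (sInf_le (isRelationIdeal_ker_eval φ hφ))

theorem isSuperHom_lift (φ : X → L) (hφ : ∀ x, φ x ∈ LieSuperalgebra.part (𝕜 := 𝕜) (deg x)) :
    IsSuperHom 𝕜 (lift φ hφ) where
  map_part := by
    rintro a _ ⟨f, hf, rfl⟩
    exact eval_mem φ hφ a f hf
  map_bracket x y := by
    obtain ⟨x, rfl⟩ := mk_surjective 𝕜 deg x
    obtain ⟨y, rfl⟩ := mk_surjective 𝕜 deg y
    exact eval_mul φ x y

theorem lift_of (φ : X → L) (hφ : ∀ x, φ x ∈ LieSuperalgebra.part (𝕜 := 𝕜) (deg x)) (x : X) :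
    lift φ hφ (of 𝕜 deg x) = φ x := by
  change eval φ (MonoidAlgebra.single (FreeMagma.of x) (1 : 𝕜)) = φ x
  rw [eval_single, one_smul]
  rfl

end lift

end FreeLieSuperalgebra

end free

/-! ### Free presentations and the Schur multiplier of a pair -/

section multiplier

/-- A free presentation `0 → R → F → L → 0` of the Lie superalgebra `L`, with `F` free on a
`ℤ/2`-graded set. -/
structure FreePresentation (𝕜 : Type u) (L : Type v) [Field 𝕜] [AddCommGroup L] [Module 𝕜 L]
    [Bracket L L] [LieSuperalgebra 𝕜 L] where
  /-- The set of generators. -/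
  X : Type w
  /-- The degrees of the generators. -/
  deg : X → ZMod 2
  /-- The projection `F → L`. -/
  π : FreeLieSuperalgebra 𝕜 deg →ₗ[𝕜] L
  isSuperHom : IsSuperHom 𝕜 π
  surjective : Function.Surjective π

namespace FreePresentation

/-- Every Lie superalgebra has a free presentation. -/
theorem nonempty (𝕜 : Type u) (L : Type v) [Field 𝕜] [AddCommGroup L] [Module 𝕜 L]
    [Bracket L L] [LieSuperalgebra 𝕜 L] : Nonempty (FreePresentation.{u, v, v} 𝕜 L) := by
  let X : Type v := Σ a : ZMod 2, ↥(LieSuperalgebra.part (𝕜 := 𝕜) (L := L) a)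
  let deg : X → ZMod 2 := fun x => x.1
  let φ : X → L := fun x => x.2.1
  have hφ : ∀ x : X, φ x ∈ LieSuperalgebra.part (𝕜 := 𝕜) (L := L) (deg x) := fun x => x.2.2
  obtain ⟨f, hf, hf'⟩ : ∃ f : FreeLieSuperalgebra 𝕜 deg →ₗ[𝕜] L, IsSuperHom 𝕜 f ∧
      ∀ x, f (FreeLieSuperalgebra.of 𝕜 deg x) = φ x :=
    ⟨_, FreeLieSuperalgebra.isSuperHom_lift φ hφ, FreeLieSuperalgebra.lift_of φ hφ⟩
  have hr : ∀ a : ZMod 2, LieSuperalgebra.part (𝕜 := 𝕜) (L := L) a ≤ LinearMap.range f :=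
    fun a l hl => ⟨FreeLieSuperalgebra.of 𝕜 deg ⟨a, l, hl⟩, hf' ⟨a, l, hl⟩⟩
  refine ⟨⟨X, deg, f, hf, LinearMap.range_eq_top.1 (eq_top_iff.2 ?_)⟩⟩
  rw [← (LieSuperalgebra.isCompl_part (𝕜 := 𝕜) (L := L)).sup_eq_top]
  exact sup_le (hr 0) (hr 1)

variable {𝕜 : Type u} {L : Type v} [Field 𝕜] [AddCommGroup L] [Module 𝕜 L]
  [Bracket L L] [LieSuperalgebra 𝕜 L] (P : FreePresentation.{u, v, w} 𝕜 L)

/-- The free Lie superalgebra `F`. -/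
abbrev F : Type (max u w) := FreeLieSuperalgebra 𝕜 P.deg

/-- The ideal of relations `R`, the kernel of `F → L`. -/
def R : Submodule 𝕜 P.F := LinearMap.ker P.π

/-- The ideal `S` of `F` with `S / R = N`, the preimage of `N`. -/
def S (N : Submodule 𝕜 L) : Submodule 𝕜 P.F := N.comap P.π

/-- The Schur multiplier `M(N, L) = (R ∩ [S, F]) / [R, F]` of the pair `(N, L)`. -/
abbrev schurMultiplier (N : Submodule 𝕜 L) : Type (max u w) :=
  ↥(P.R ⊓ commutator 𝕜 (P.S N) ⊤) ⧸
    (commutator 𝕜 P.R ⊤).submoduleOf (P.R ⊓ commutator 𝕜 (P.S N) ⊤)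

end FreePresentation

end multiplier

end LieSuper

end

namespace LieSuper

open Module Submodule LieSuperalgebra

/-! ### Spans, lifts and bases of subspaces -/

section linear

variable (𝕜 : Type*) {K L : Type*} [Field 𝕜] [AddCommGroup L] [Module 𝕜 L] [AddCommGroup K]
  [Module 𝕜 K]

/-! Everything happens in `F / [R, F]`, where R becomes central, so a bracket of two classes depends
only on their images in L. Hence `[S, F] / [R, F]` is spanned by brackets of lifts of basis elements
of N with lifts of basis elements of L. Take a homogeneous basis of L extending one of N. Graded
antisymmetry, with 2 invertible, leaves these pairs: i < j inside N, (i, i) for odd i in N, and one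
index in N with one in the complement (`IsSuperHom.commutator_comap_le`). Counting them
(`PairIndex.two_mul_card`) gives exactly the stated bound, and M(N, L) is the subspace of this space
coming from `R ∩ [S, F]`.

If equality holds, that subspace is everything, so `[S, F] ⊆ R + [R, F] = R`, which says `[N, L] =
0`.

If L is abelian, then `[S, F] ⊆ R`, and it remains to see that the spanning brackets are independent
modulo `[R, F]`. An even graded antisymmetric form B on L with values in W defines a central
extension of L by W. Lifting F to it yields a linear map Φ on F with `Φ [x, y] = B (π x, π y)`
(`FreePresentation.exists_linearMap_bracket`), which kills `[R, F]`. For B = x ⊗ y - (-1)^(|x||y|) y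
⊗ x the values on the chosen pairs are independent (`linearIndependent_squareForm`). -/

theorem bracket_mem_commutator [Bracket L L] {A B : Submodule 𝕜 L} {x y : L} (hx : x ∈ A) (hy : y ∈ B) :
    ⁅x, y⁆ ∈ commutator 𝕜 A B :=
  subset_span ⟨x, hx, y, hy, rfl⟩

variable {𝕜}

/-- Used to replace an element of S or of F, modulo R, by a combination of chosen lifts of basis
vectors. -/
theorem exists_sub_mem_ker_of_mem_span {ι : Type*} (f : K →ₗ[𝕜] L) {x : ι → K} {s : K}
    (hs : f s ∈ span 𝕜 (Set.range (f ∘ x))) :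
    ∃ s' ∈ span 𝕜 (Set.range x), s - s' ∈ LinearMap.ker f := by
  rw [Set.range_comp, ← map_span] at hs
  obtain ⟨s', hs', e⟩ := hs
  exact ⟨s', hs', by rw [LinearMap.mem_ker, map_sub, e, sub_self]⟩

theorem span_range_coe_basis {ι : Type*} {U : Submodule 𝕜 L} (b : Basis ι 𝕜 U) :
    span 𝕜 (Set.range fun i => (b i : L)) = U := by
  have h : (fun i => (b i : L)) = U.subtype ∘ b := rfl
  rw [h, Set.range_comp, ← map_span, b.span_eq, Submodule.map_top, range_subtype]

theorem linearIndependent_coe_basis {ι : Type*} {U : Submodule 𝕜 L} (b : Basis ι 𝕜 U) :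
    LinearIndependent 𝕜 fun i => (b i : L) :=
  b.linearIndependent.map' U.subtype (ker_subtype U)

end linear

/-! ### The bracket and the grading -/

section basics

variable (𝕜 : Type*) {L : Type*} [Field 𝕜] [AddCommGroup L] [Module 𝕜 L] [Bracket L L]
  [LieSuperalgebra 𝕜 L]

/-- The bracket as a bilinear map. -/
noncomputable def bracketₗ (L : Type*) [AddCommGroup L] [Module 𝕜 L] [Bracket L L]
    [LieSuperalgebra 𝕜 L] : L →ₗ[𝕜] L →ₗ[𝕜] L :=
  LinearMap.mk₂ 𝕜 (fun x y => ⁅x, y⁆) (add_bracket (𝕜 := 𝕜)) smul_bracket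
    (bracket_add (𝕜 := 𝕜)) bracket_smul

@[simp]
theorem bracketₗ_apply (x y : L) : bracketₗ 𝕜 L x y = ⁅x, y⁆ := rfl

theorem exists_add_of_part (x : L) :
    ∃ y ∈ part (𝕜 := 𝕜) (L := L) 0, ∃ z ∈ part (𝕜 := 𝕜) (L := L) 1, y + z = x := by
  have h : x ∈ part (𝕜 := 𝕜) (L := L) 0 ⊔ part 1 := by
    rw [(isCompl_part (𝕜 := 𝕜) (L := L)).sup_eq_top]
    trivial
  exact mem_sup.1 h

variable {𝕜}

theorem zmod_two_cases (a : ZMod 2) : a = 0 ∨ a = 1 := by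
  revert a
  decide

theorem eq_zero_of_mem_part {a c : ZMod 2} (h : a ≠ c) {x : L}
    (ha : x ∈ part (𝕜 := 𝕜) (L := L) a) (hc : x ∈ part (𝕜 := 𝕜) (L := L) c) : x = 0 := by
  have hd := disjoint_def.1 (isCompl_part (𝕜 := 𝕜) (L := L)).disjoint
  rcases zmod_two_cases a with rfl | rfl <;> rcases zmod_two_cases c with rfl | rfl
  · exact absurd rfl h
  · exact hd x ha hc
  · exact hd x hc ha
  · exact absurd rfl h

end basics

/-! ### Kernels and lifts of super homomorphisms -/

section superHom

variable {𝕜 K L : Type*} [Field 𝕜] [AddCommGroup L] [Module 𝕜 L] [Bracket L L]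
  [LieSuperalgebra 𝕜 L] [AddCommGroup K] [Module 𝕜 K] [Bracket K K] [LieSuperalgebra 𝕜 K]
  {f : K →ₗ[𝕜] L}

/-- The kernel is graded: `f y = -f z` is both even and odd. -/
theorem IsSuperHom.map_eq_zero_of_add (hf : IsSuperHom 𝕜 f) {y z : K}
    (hy : y ∈ part (𝕜 := 𝕜) 0) (hz : z ∈ part (𝕜 := 𝕜) 1) (h : f (y + z) = 0) :
    f y = 0 ∧ f z = 0 := by
  rw [map_add] at h
  have h0 : f y = 0 := eq_zero_of_mem_part (𝕜 := 𝕜) zero_ne_one (hf.map_part _ _ hy) (by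
    rw [eq_neg_of_add_eq_zero_left h]
    exact neg_mem (hf.map_part _ _ hz))
  exact ⟨h0, by rwa [h0, zero_add] at h⟩

theorem bracket_mem_commutator_of_homogeneous {A : Submodule 𝕜 K} {a c : ZMod 2} {x r : K}
    (hx : x ∈ part (𝕜 := 𝕜) a) (hr : r ∈ part (𝕜 := 𝕜) c) (hrA : r ∈ A) :
    ⁅x, r⁆ ∈ commutator 𝕜 A ⊤ := by
  rw [antisymm (𝕜 := 𝕜) a c x r hx hr]
  exact neg_mem (smul_mem _ _ (bracket_mem_commutator 𝕜 hrA mem_top))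

/-- `[R, F]` is spanned by brackets with R on the left; this puts R on the right. Antisymmetry is
available only for homogeneous elements, so both entries are split, and gradedness of the kernel
keeps the components of r in it. -/
theorem IsSuperHom.bracket_mem_commutator_ker (hf : IsSuperHom 𝕜 f) (x : K) {r : K}
    (hr : f r = 0) : ⁅x, r⁆ ∈ commutator 𝕜 (LinearMap.ker f) ⊤ := by
  obtain ⟨x0, hx0, x1, hx1, rfl⟩ := exists_add_of_part 𝕜 x
  obtain ⟨r0, hr0, r1, hr1, rfl⟩ := exists_add_of_part 𝕜 r
  obtain ⟨h0, h1⟩ := hf.map_eq_zero_of_add hr0 hr1 hr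
  rw [add_bracket (𝕜 := 𝕜), bracket_add (𝕜 := 𝕜), bracket_add (𝕜 := 𝕜)]
  exact add_mem
    (add_mem (bracket_mem_commutator_of_homogeneous hx0 hr0 h0)
      (bracket_mem_commutator_of_homogeneous hx0 hr1 h1))
    (add_mem (bracket_mem_commutator_of_homogeneous hx1 hr0 h0)
      (bracket_mem_commutator_of_homogeneous hx1 hr1 h1))

/-- Take the component of degree a of any preimage; the other component maps into both parts, hence
to 0. -/
theorem IsSuperHom.exists_homogeneous_preimage (hf : IsSuperHom 𝕜 f)
    (hs : Function.Surjective f) (a : ZMod 2) {y : L} (hy : y ∈ part (𝕜 := 𝕜) a) :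
    ∃ x ∈ part (𝕜 := 𝕜) (L := K) a, f x = y := by
  obtain ⟨x, rfl⟩ := hs y
  obtain ⟨x0, hx0, x1, hx1, rfl⟩ := exists_add_of_part 𝕜 x
  have h0 := hf.map_part _ _ hx0
  have h1 := hf.map_part _ _ hx1
  rcases zmod_two_cases a with rfl | rfl
  · refine ⟨x0, hx0, ?_⟩
    have h : f x1 = 0 := eq_zero_of_mem_part (𝕜 := 𝕜) zero_ne_one
      (by simpa using sub_mem hy h0) h1
    simp [h]
  · refine ⟨x1, hx1, ?_⟩
    have h : f x0 = 0 := eq_zero_of_mem_part (𝕜 := 𝕜) zero_ne_one h0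
      (by simpa using sub_mem hy h1)
    simp [h]

end superHom

/-! ### Index pairs and their number -/

section pairs

variable {α β : Type*} [LinearOrder α]

/-- The index set of a basis of the image of `N ⊗ L` in the super exterior square of `L`, where
`α` indexes a homogeneous basis of `N` with degrees `d` and `β` indexes a homogeneous basis of a
complement of `N`. -/
abbrev PairIndex (β : Type*) (d : α → ZMod 2) :=
  {x : α × α // x.1 < x.2 ∨ (x.1 = x.2 ∧ d x.1 = 1)} ⊕ (α × β)

/-- The pair of indices in `α ⊕ β` named by an element of `PairIndex`. -/
def PairIndex.toPair {d : α → ZMod 2} : PairIndex β d → (α ⊕ β) × (α ⊕ β)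
  | Sum.inl x => (Sum.inl x.1.1, Sum.inl x.1.2)
  | Sum.inr x => (Sum.inl x.1, Sum.inr x.2)

theorem PairIndex.toPair_injective {d : α → ZMod 2} :
    Function.Injective (PairIndex.toPair (β := β) (d := d)) := by
  rintro (⟨⟨i, j⟩, h⟩ | ⟨i, j⟩) (⟨⟨i', j'⟩, h'⟩ | ⟨i', j'⟩) e <;>
    simp_all [PairIndex.toPair]

/-- Each unordered pair is listed once: i < j excludes j < i, and a mixed pair always has its
N-index first. So only diagonal pairs meet their swaps. -/
theorem PairIndex.toPair_eq_of_eq_swap {d : α → ZMod 2} {t t' : PairIndex β d}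
    (h : t.toPair = t'.toPair.swap) : t = t' ∧ t.toPair.1 = t.toPair.2 := by
  rcases t with (⟨⟨i, j⟩, hi⟩ | ⟨i, j⟩) <;> rcases t' with (⟨⟨i', j'⟩, hi'⟩ | ⟨i', j'⟩) <;>
    simp_all [PairIndex.toPair]; grind

/-- The square α × α splits into i < j, j < i and the diagonal, the first two being equinumerous.
The identity is doubled and free of subtraction so as to live in ℕ. -/
theorem PairIndex.two_mul_card [Fintype α] [Fintype β] (d : α → ZMod 2) :
    2 * Fintype.card (PairIndex β d) + Fintype.card α =
      Fintype.card α ^ 2 + 2 * Fintype.card {i // d i = 1}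
        + 2 * (Fintype.card α * Fintype.card β) := by
  classical
  have e1 : Fintype.card {x : α × α // x.1 < x.2 ∨ (x.1 = x.2 ∧ d x.1 = 1)} =
      Fintype.card {x : α × α // x.1 < x.2} + Fintype.card {i // d i = 1} := by
    rw [Fintype.card_subtype_or_disjoint]
    · congr 1
      refine Fintype.card_congr ⟨fun x => ⟨x.1.1, x.2.2⟩, fun i => ⟨(i.1, i.1), rfl, i.2⟩, ?_, ?_⟩
      · rintro ⟨⟨i, j⟩, h, h'⟩
        simp only at h
        subst h
        rfl
      · intro i
        rfl
    · rw [Pi.disjoint_iff]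
      rintro ⟨i, j⟩
      rw [Prop.disjoint_iff]
      rintro ⟨h, h', -⟩
      exact h.ne h'
  have e2 : Fintype.card {x : α × α // x.2 < x.1} = Fintype.card {x : α × α // x.1 < x.2} :=
    Fintype.card_congr ⟨fun x => ⟨x.1.swap, x.2⟩, fun x => ⟨x.1.swap, x.2⟩, fun _ => rfl,
      fun _ => rfl⟩
  have e3 : Fintype.card {x : α × α // ¬ x.1 < x.2} =
      Fintype.card {x : α × α // x.2 < x.1} + Fintype.card α := by
    rw [Fintype.card_congr (Equiv.subtypeEquivRight (q := fun x : α × α => x.2 < x.1 ∨ x.2 = x.1)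
      fun x => by rw [not_lt, le_iff_lt_or_eq]), Fintype.card_subtype_or_disjoint]
    · congr 1
      refine Fintype.card_congr ⟨fun x => x.1.1, fun i => ⟨(i, i), rfl⟩, ?_, ?_⟩
      · rintro ⟨⟨i, j⟩, h⟩
        simp only at h
        subst h
        rfl
      · intro i
        rfl
    · rw [Pi.disjoint_iff]
      rintro ⟨i, j⟩
      rw [Prop.disjoint_iff]
      rintro ⟨h, h'⟩
      exact h.ne h'
  have e4 := Fintype.card_subtype_compl (fun x : α × α => x.1 < x.2)
  have e5 := Fintype.card_subtype_le (fun x : α × α => x.1 < x.2)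
  rw [Fintype.card_prod] at e4 e5
  rw [Fintype.card_sum, e1, Fintype.card_prod, pow_two]
  omega

end pairs

/-! ### Spanning `[S, F]` modulo `[R, F]` -/

section upperBound

variable {𝕜 K L α β : Type*} [Field 𝕜] [AddCommGroup L] [Module 𝕜 L] [Bracket L L]
  [LieSuperalgebra 𝕜 L] [AddCommGroup K] [Module 𝕜 K] [Bracket K K] [LieSuperalgebra 𝕜 K]
  [LinearOrder α] {f : K →ₗ[𝕜] L}

/-- Modulo the kernel, both entries of a bracket are combinations of the lifts x i, and the errors
contribute only to `[R, F]`. Antisymmetry then reorders brackets of lifts into the listed pairs. -/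
theorem IsSuperHom.commutator_comap_le (hf : IsSuperHom 𝕜 f) (h2 : (2 : 𝕜) ≠ 0)
    {N : Submodule 𝕜 L} {d : α ⊕ β → ZMod 2} {x : α ⊕ β → K}
    (hx : ∀ i, x i ∈ part (𝕜 := 𝕜) (d i))
    (htop : span 𝕜 (Set.range (f ∘ x)) = ⊤)
    (hN : span 𝕜 (Set.range (f ∘ x ∘ Sum.inl)) = N) :
    commutator 𝕜 (N.comap f) ⊤ ≤
      span 𝕜 (Set.range fun t : PairIndex β (d ∘ Sum.inl) => ⁅x t.toPair.1, x t.toPair.2⁆)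
        ⊔ commutator 𝕜 (LinearMap.ker f) ⊤ := by
  set T := span 𝕜 (Set.range fun t : PairIndex β (d ∘ Sum.inl) => ⁅x t.toPair.1, x t.toPair.2⁆)
  have hlt : ∀ i j : α, i < j → ⁅x (Sum.inl i), x (Sum.inl j)⁆ ∈ T := fun i j hij =>
    subset_span ⟨Sum.inl ⟨(i, j), Or.inl hij⟩, rfl⟩
  have hgen : ∀ (i : α) (j : α ⊕ β), ⁅x (Sum.inl i), x j⁆ ∈ T := by
    rintro i (j | j)
    · rcases lt_trichotomy i j with h | rfl | h
      · exact hlt i j h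
      · rcases zmod_two_cases (d (Sum.inl i)) with h | h
        -- For even x, antisymmetry reads `[x, x] = -[x, x]`, so `[x, x] = 0` as 2 ≠ 0.
        · have e := antisymm (𝕜 := 𝕜) _ _ _ _ (hx (Sum.inl i)) (hx (Sum.inl i))
          rw [h, ZMod.val_zero, zero_mul, pow_zero, one_smul, eq_neg_iff_add_eq_zero,
            ← two_smul 𝕜, smul_eq_zero] at e
          rw [e.resolve_left h2]
          exact zero_mem _
        · exact subset_span ⟨Sum.inl ⟨(i, i), Or.inr ⟨rfl, h⟩⟩, rfl⟩
      · rw [antisymm (𝕜 := 𝕜) _ _ _ _ (hx (Sum.inl i)) (hx (Sum.inl j))]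
        exact neg_mem (smul_mem _ _ (hlt j i h))
    · exact subset_span ⟨Sum.inr (i, j), rfl⟩
  have hspan : ∀ s ∈ span 𝕜 (Set.range (x ∘ Sum.inl)), ∀ y ∈ span 𝕜 (Set.range x),
      ⁅s, y⁆ ∈ T := by
    intro s hs y hy
    have h := apply_mem_map₂ (bracketₗ 𝕜 K) hs hy
    rw [map₂_span_span] at h
    refine span_le.2 ?_ h
    rintro _ ⟨_, ⟨i, rfl⟩, _, ⟨j, rfl⟩, rfl⟩
    exact hgen i j
  refine span_le.2 ?_
  rintro _ ⟨s, hs, y, -, rfl⟩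
  obtain ⟨s', hs', es⟩ := exists_sub_mem_ker_of_mem_span f (x := x ∘ Sum.inl) (s := s)
    (by rw [hN]; exact hs)
  obtain ⟨y', hy', ey⟩ := exists_sub_mem_ker_of_mem_span f (x := x) (s := y)
    (by rw [htop]; trivial)
  have e : ⁅s, y⁆ = ⁅s', y'⁆ + (⁅s', y - y'⁆ + ⁅s - s', y⁆) := by
    simp only [← bracketₗ_apply 𝕜, map_sub, LinearMap.sub_apply]
    abel
  rw [e]
  exact add_mem (mem_sup_left (hspan s' hs' y' hy'))
    (mem_sup_right (add_mem (hf.bracket_mem_commutator_ker s' ey)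
      (bracket_mem_commutator 𝕜 es mem_top)))

end upperBound

/-! ### Homogeneous bases adapted to N -/

section adaptedBasis

variable {𝕜 L : Type*} [Field 𝕜] [AddCommGroup L] [Module 𝕜 L] [Bracket L L]
  [LieSuperalgebra 𝕜 L] [FiniteDimensional 𝕜 L]

/-- A homogeneous basis of `L` that extends a homogeneous basis of a sub-superspace `N`. -/
theorem exists_adapted_basis {N : Submodule 𝕜 L}
    (hN : IsSubsuperspace (part (𝕜 := 𝕜) (L := L)) N) :
    ∃ (p k : ℕ) (b : Basis (Fin p ⊕ Fin k) 𝕜 L) (d : Fin p ⊕ Fin k → ZMod 2),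
      p = finrank 𝕜 ↥(N ⊓ part (𝕜 := 𝕜) 0) + finrank 𝕜 ↥(N ⊓ part (𝕜 := 𝕜) 1) ∧
      (∀ i, b i ∈ part (𝕜 := 𝕜) (d i)) ∧ span 𝕜 (Set.range (b ∘ Sum.inl)) = N ∧
      Fintype.card {i // d (Sum.inl i) = 1} = finrank 𝕜 ↥(N ⊓ part (𝕜 := 𝕜) 1) := by
  have hc := isCompl_part (𝕜 := 𝕜) (L := L)
  have hsplit := (isSubsuperspace_iff 𝕜 hc N).1 hN
  -- Complements are taken inside each homogeneous part, so that C0 ⊔ C1 is a graded complement of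
  -- N.
  obtain ⟨C0, hd0, hs0⟩ := IsModularLattice.exists_disjoint_and_sup_eq
    (inf_le_right : N ⊓ part (𝕜 := 𝕜) 0 ≤ _)
  obtain ⟨C1, hd1, hs1⟩ := IsModularLattice.exists_disjoint_and_sup_eq
    (inf_le_right : N ⊓ part (𝕜 := 𝕜) 1 ≤ _)
  have hC0 : C0 ≤ part (𝕜 := 𝕜) 0 := hs0 ▸ le_sup_right
  have hC1 : C1 ≤ part (𝕜 := 𝕜) 1 := hs1 ▸ le_sup_right
  let b0 := finBasis 𝕜 ↥(N ⊓ part (𝕜 := 𝕜) 0)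
  let b1 := finBasis 𝕜 ↥(N ⊓ part (𝕜 := 𝕜) 1)
  let c0 := finBasis 𝕜 C0
  let c1 := finBasis 𝕜 C1
  let v := Sum.elim (fun i => (b0 i : L)) (fun i => (b1 i : L))
  let w := Sum.elim (fun i => (c0 i : L)) (fun i => (c1 i : L))
  have hv : span 𝕜 (Set.range v) = N := by
    rw [Set.Sum.elim_range, span_union, span_range_coe_basis, span_range_coe_basis]
    exact hN.symm
  have hw : span 𝕜 (Set.range w) = C0 ⊔ C1 := by
    rw [Set.Sum.elim_range, span_union, span_range_coe_basis, span_range_coe_basis]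
  have lv : LinearIndependent 𝕜 v := by
    refine (linearIndependent_coe_basis b0).sum_type (linearIndependent_coe_basis b1) ?_
    rw [span_range_coe_basis, span_range_coe_basis]
    exact hc.disjoint.mono inf_le_right inf_le_right
  have lw : LinearIndependent 𝕜 w := by
    refine (linearIndependent_coe_basis c0).sum_type (linearIndependent_coe_basis c1) ?_
    rw [span_range_coe_basis, span_range_coe_basis]
    exact hc.disjoint.mono hC0 hC1
  have lvw : LinearIndependent 𝕜 (Sum.elim v w) := by
    refine lv.sum_type lw ?_
    rw [hv, hw, disjoint_def]
    intro x hx hx'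
    obtain ⟨y, hy, z, hz, rfl⟩ := mem_sup.1 hx'
    -- Gradedness of N puts both components of y + z in N, where C0 and C1 meet it trivially.
    obtain ⟨h0, h1⟩ := hsplit y (hC0 hy) z (hC1 hz) hx
    rw [disjoint_def.1 hd0 y ⟨h0, hC0 hy⟩ hy, disjoint_def.1 hd1 z ⟨h1, hC1 hz⟩ hz, add_zero]
  have svw : ⊤ ≤ span 𝕜 (Set.range (Sum.elim v w)) := by
    rw [Set.Sum.elim_range, span_union, hv, hw, ← hc.sup_eq_top]
    refine sup_le ?_ ?_
    · rw [← hs0]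
      exact sup_le_sup inf_le_left le_sup_left
    · rw [← hs1]
      exact sup_le_sup inf_le_left le_sup_right
  let e := Equiv.sumCongr (finSumFinEquiv (m := finrank 𝕜 ↥(N ⊓ part (𝕜 := 𝕜) 0))
    (n := finrank 𝕜 ↥(N ⊓ part (𝕜 := 𝕜) 1)))
    (finSumFinEquiv (m := finrank 𝕜 C0) (n := finrank 𝕜 C1))
  let deg := fun i => Sum.elim (Sum.elim (fun _ => (0 : ZMod 2)) fun _ => 1)
    (Sum.elim (fun _ => 0) fun _ => 1) (e.symm i)
  refine ⟨_, _, (Basis.mk lvw svw).reindex e, deg, rfl, ?_, ?_, ?_⟩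
  · intro i
    obtain ⟨i, rfl⟩ := e.surjective i
    simp only [deg, Basis.reindex_apply, Basis.mk_apply, e.symm_apply_apply]
    rcases i with (i | i) | (i | i)
    · exact (b0 i).2.2
    · exact (b1 i).2.2
    · exact hC0 (c0 i).2
    · exact hC1 (c1 i).2
  · have h : (Basis.mk lvw svw).reindex e ∘ Sum.inl = v ∘ finSumFinEquiv.symm := by
      funext i
      simp [e]
    rw [h, finSumFinEquiv.symm.surjective.range_comp, hv]
  · refine (Fintype.card_congr (Equiv.ofBijective
      (fun i => ⟨finSumFinEquiv (Sum.inr i), by simp [e, deg]⟩)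
      ⟨fun i j h => ?_, ?_⟩)).symm.trans (Fintype.card_fin _)
    · simpa using h
    · rintro ⟨i, hi⟩
      obtain ⟨i | i, rfl⟩ := finSumFinEquiv.surjective i
      · simp [e, deg] at hi
      · exact ⟨i, rfl⟩

end adaptedBasis

/-! ### Central extensions and linear maps on F -/

section centralExtension

variable {𝕜 L W : Type*} [Field 𝕜] [AddCommGroup L] [Module 𝕜 L] [AddCommGroup W] [Module 𝕜 W]

/-- The space `L × W` with the bracket `⁅(x, u), (y, v)⁆ = (0, B x y)`: the central extension by `W`
of the abelian Lie superalgebra on `L` that is given by the bilinear map `B`. -/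
def CentralExtension (_ : L →ₗ[𝕜] L →ₗ[𝕜] W) : Type _ := L × W

namespace CentralExtension

variable (B : L →ₗ[𝕜] L →ₗ[𝕜] W)

instance : AddCommGroup (CentralExtension B) := inferInstanceAs (AddCommGroup (L × W))

instance : Module 𝕜 (CentralExtension B) := inferInstanceAs (Module 𝕜 (L × W))

instance : Bracket (CentralExtension B) (CentralExtension B) where
  bracket p q := ((0 : L), B p.1 q.1)

/-- The projection to `L`. -/
def fst : CentralExtension B →ₗ[𝕜] L := LinearMap.fst 𝕜 L W

/-- The projection to `W`. -/
def snd : CentralExtension B →ₗ[𝕜] W := LinearMap.snd 𝕜 L W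

theorem fst_bracket (p q : CentralExtension B) : fst B ⁅p, q⁆ = 0 := rfl

theorem snd_bracket (p q : CentralExtension B) : snd B ⁅p, q⁆ = B (fst B p) (fst B q) := rfl

variable {B} in
theorem ext {p q : CentralExtension B} (h1 : fst B p = fst B q) (h2 : snd B p = snd B q) :
    p = q :=
  Prod.ext h1 h2

/-- Brackets have zero L-component and B sees only L-components; this makes every term of the Jacobi
identity vanish. -/
theorem bracket_bracket (p q r : CentralExtension B) : ⁅p, ⁅q, r⁆⁆ = 0 :=
  ext rfl (by rw [snd_bracket, fst_bracket, map_zero, map_zero])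

/-- The Lie superalgebra structure on `L × W`, for `B` even and graded antisymmetric. -/
abbrev lieSuperalgebra [Bracket L L] [LieSuperalgebra 𝕜 L] {V : ZMod 2 → Submodule 𝕜 W}
    (hV : IsCompl (V 0) (V 1))
    (hB : ∀ (a c : ZMod 2) (x y : L), x ∈ part (𝕜 := 𝕜) a → y ∈ part (𝕜 := 𝕜) c →
      B x y ∈ V (a + c))
    (hB' : ∀ (a c : ZMod 2) (x y : L), x ∈ part (𝕜 := 𝕜) a → y ∈ part (𝕜 := 𝕜) c →
      B x y = -((-1 : 𝕜) ^ (a.val * c.val) • B y x)) :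
    LieSuperalgebra 𝕜 (CentralExtension B) where
  part a := (part (𝕜 := 𝕜) (L := L) a).comap (fst B) ⊓ (V a).comap (snd B)
  isCompl_part := by
    have hL := isCompl_part (𝕜 := 𝕜) (L := L)
    constructor
    · rw [disjoint_def]
      rintro x ⟨h1, h2⟩ ⟨h3, h4⟩
      exact ext (disjoint_def.1 hL.disjoint _ h1 h3) (disjoint_def.1 hV.disjoint _ h2 h4)
    · rw [codisjoint_iff, eq_top_iff]
      rintro ⟨x, u⟩ -
      have hu : u ∈ V 0 ⊔ V 1 := by
        rw [hV.sup_eq_top]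
        trivial
      obtain ⟨x0, hx0, x1, hx1, rfl⟩ := exists_add_of_part 𝕜 x
      obtain ⟨u0, hu0, u1, hu1, rfl⟩ := mem_sup.1 hu
      exact mem_sup.2 ⟨(x0, u0), ⟨hx0, hu0⟩, (x1, u1), ⟨hx1, hu1⟩, rfl⟩
  add_bracket x y z := ext (by simp [fst_bracket]) (by simp [snd_bracket])
  bracket_add x y z := ext (by simp [fst_bracket]) (by simp [snd_bracket])
  smul_bracket c x y := ext (by simp [fst_bracket]) (by simp [snd_bracket])
  bracket_smul c x y := ext (by simp [fst_bracket]) (by simp [snd_bracket])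
  bracket_mem a c x y hx hy := ⟨zero_mem (part (𝕜 := 𝕜) (L := L) (a + c)), hB a c _ _ hx.1 hy.1⟩
  antisymm a c x y hx hy := ext (by simp [fst_bracket]) (by
    simp only [map_neg, map_smul, snd_bracket]
    exact hB' a c _ _ hx.1 hy.1)
  jacobi a b c x y z _ _ _ := by
    simp only [bracket_bracket, smul_zero, add_zero]

end CentralExtension

/-- If `L` is abelian, then every even graded antisymmetric bilinear map on `L` factors through the
commutators of each free Lie superalgebra that is mapped onto `L`. -/
theorem FreePresentation.exists_linearMap_bracket [Bracket L L] [LieSuperalgebra 𝕜 L]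
    (P : FreePresentation 𝕜 L) (hL : IsAbelian L) (B : L →ₗ[𝕜] L →ₗ[𝕜] W)
    {V : ZMod 2 → Submodule 𝕜 W} (hV : IsCompl (V 0) (V 1))
    (hB : ∀ (a c : ZMod 2) (x y : L), x ∈ part (𝕜 := 𝕜) a → y ∈ part (𝕜 := 𝕜) c →
      B x y ∈ V (a + c))
    (hB' : ∀ (a c : ZMod 2) (x y : L), x ∈ part (𝕜 := 𝕜) a → y ∈ part (𝕜 := 𝕜) c →
      B x y = -((-1 : 𝕜) ^ (a.val * c.val) • B y x)) :
    ∃ Φ : P.F →ₗ[𝕜] W, ∀ x y : P.F, Φ ⁅x, y⁆ = B (P.π x) (P.π y) := by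
  let _ := CentralExtension.lieSuperalgebra B hV hB hB'
  -- The W-component 0 lies in every homogeneous part, so φ preserves degrees.
  let φ : P.X → CentralExtension B := fun x => (P.π (FreeLieSuperalgebra.of 𝕜 P.deg x), (0 : W))
  have hφ : ∀ x, φ x ∈ part (𝕜 := 𝕜) (P.deg x) := fun x => by
    change φ x ∈ (part (𝕜 := 𝕜) (L := L) (P.deg x)).comap (CentralExtension.fst B) ⊓
      (V (P.deg x)).comap (CentralExtension.snd B)
    refine ⟨P.isSuperHom.map_part _ _ ⟨FreeNonUnitalNonAssocAlgebra.of 𝕜 x, ?_, rfl⟩,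
      zero_mem (V (P.deg x))⟩
    classical
    intro m hm
    have e : (FreeNonUnitalNonAssocAlgebra.of 𝕜 x).coeff m =
      (Finsupp.single (FreeMagma.of x) (1 : 𝕜)) m := rfl
    rw [e, Finsupp.single_apply] at hm
    by_cases h : FreeMagma.of x = m
    · rw [← h]
      rfl
    · simp [h] at hm
  -- On products both sides vanish: the left by the definition of the bracket, the right because L
  -- is abelian.
  have hword : ∀ m : FreeMagma P.X, CentralExtension.fst B (FreeLieSuperalgebra.evalWord φ m) =
      P.π (FreeLieSuperalgebra.mk 𝕜 P.deg (MonoidAlgebra.single m (1 : 𝕜))) := by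
    intro m
    induction m with
    | ih1 x => rfl
    | ih2 p q _ _ =>
      have e : (MonoidAlgebra.single (p * q) (1 : 𝕜) : FreeNonUnitalNonAssocAlgebra 𝕜 P.X) =
          MonoidAlgebra.single p 1 * MonoidAlgebra.single q 1 := by
        rw [MonoidAlgebra.single_mul_single, one_mul]
      rw [e, FreeLieSuperalgebra.mk_mul, P.isSuperHom.map_bracket, hL]
      rfl
  have hfst : ∀ x : P.F, CentralExtension.fst B (FreeLieSuperalgebra.lift φ hφ x) = P.π x := by
    intro x
    obtain ⟨x, rfl⟩ := FreeLieSuperalgebra.mk_surjective 𝕜 P.deg x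
    change CentralExtension.fst B (FreeLieSuperalgebra.eval φ x) = _
    induction x using MonoidAlgebra.induction_linear with
    | zero => simp
    | add f g hf hg => simp only [map_add, hf, hg]
    | single m r =>
      have e : (MonoidAlgebra.single m r : FreeNonUnitalNonAssocAlgebra 𝕜 P.X) =
          r • MonoidAlgebra.single m (1 : 𝕜) := by
        rw [MonoidAlgebra.smul_single, smul_eq_mul, mul_one]
      rw [FreeLieSuperalgebra.eval_single, e, map_smul, map_smul, map_smul, hword]
  refine ⟨CentralExtension.snd B ∘ₗ FreeLieSuperalgebra.lift φ hφ, fun x y => ?_⟩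
  rw [LinearMap.comp_apply, (FreeLieSuperalgebra.isSuperHom_lift φ hφ).map_bracket,
    CentralExtension.snd_bracket, hfst, hfst]

end centralExtension

/-! ### The universal graded antisymmetric form in coordinates -/

section squareForm

variable {𝕜 L ι : Type*} [Field 𝕜] [AddCommGroup L] [Module 𝕜 L] (b : Basis ι 𝕜 L)
  (d : ι → ZMod 2)

/-- In coordinates with respect to a homogeneous basis `b` with degrees `d`, the bilinear map
`(x, y) ↦ x ⊗ y - (-1) ^ (|x| |y|) y ⊗ x`. -/
noncomputable def squareForm : L →ₗ[𝕜] L →ₗ[𝕜] (ι × ι → 𝕜) :=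
  LinearMap.mk₂ 𝕜 (fun x y p => b.repr x p.1 * b.repr y p.2
      - (-1) ^ ((d p.1).val * (d p.2).val) * (b.repr x p.2 * b.repr y p.1))
    (fun _ _ _ => funext fun _ => by simp; ring) (fun _ _ _ => funext fun _ => by simp; ring)
    (fun _ _ _ => funext fun _ => by simp; ring) (fun _ _ _ => funext fun _ => by simp; ring)

theorem squareForm_apply (x y : L) (p : ι × ι) :
    squareForm b d x y p = b.repr x p.1 * b.repr y p.2
      - (-1) ^ ((d p.1).val * (d p.2).val) * (b.repr x p.2 * b.repr y p.1) := rfl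

variable (𝕜) in
/-- The homogeneous parts of the space of functions on `ι × ι`. -/
def squarePart (a : ZMod 2) : Submodule 𝕜 (ι × ι → 𝕜) where
  carrier := {g | ∀ p, d p.1 + d p.2 ≠ a → g p = 0}
  zero_mem' _ _ := rfl
  add_mem' hf hg p hp := by rw [Pi.add_apply, hf p hp, hg p hp, add_zero]
  smul_mem' c f hf p hp := by rw [Pi.smul_apply, hf p hp, smul_zero]

theorem isCompl_squarePart : IsCompl (squarePart 𝕜 d 0) (squarePart 𝕜 d 1) := by
  classical
  constructor
  · rw [disjoint_def]
    intro g h0 h1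
    funext p
    by_cases h : d p.1 + d p.2 = 0
    · exact h1 p (by rw [h]; decide)
    · exact h0 p h
  · rw [codisjoint_iff, eq_top_iff]
    intro g _
    refine mem_sup.2 ⟨fun p => if d p.1 + d p.2 = 0 then g p else 0, fun p hp => if_neg hp,
      fun p => if d p.1 + d p.2 = 0 then 0 else g p, fun p hp => ?_, ?_⟩
    · exact if_pos ((zmod_two_cases _).resolve_right hp)
    · funext p
      by_cases h : d p.1 + d p.2 = 0 <;> simp [h]

variable [Bracket L L] [LieSuperalgebra 𝕜 L] {b d}

/-- Group the expansion of x by degree: the terms of degree other than a sum to x minus an element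
of `part a`, hence to an element of both parts, which is 0. -/
theorem repr_eq_zero_of_mem_part [Fintype ι] (hb : ∀ i, b i ∈ part (𝕜 := 𝕜) (d i)) {a : ZMod 2}
    {x : L} (hx : x ∈ part (𝕜 := 𝕜) a) {i : ι} (hi : d i ≠ a) : b.repr x i = 0 := by
  classical
  have hsum : ∑ j with d j = a, b.repr x j • b j + ∑ j with d j ≠ a, b.repr x j • b j = x := by
    rw [Finset.sum_filter_add_sum_filter_not, b.sum_repr]
  have h0 : ∑ j with d j = a, b.repr x j • b j ∈ part (𝕜 := 𝕜) a :=
    sum_mem fun j hj => smul_mem _ _ ((Finset.mem_filter.1 hj).2 ▸ hb j)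
  have h1 : ∑ j with d j ≠ a, b.repr x j • b j ∈ part (𝕜 := 𝕜) (a + 1) := by
    refine sum_mem fun j hj => smul_mem _ _ ?_
    have h : ∀ s t : ZMod 2, s ≠ t → s = t + 1 := by decide
    exact h _ _ (Finset.mem_filter.1 hj).2 ▸ hb j
  have hz : ∑ j with d j ≠ a, b.repr x j • b j = 0 := by
    refine eq_zero_of_mem_part (𝕜 := 𝕜) (a := a) (c := a + 1) ?_ ?_ h1
    · exact (by decide : ∀ s : ZMod 2, s ≠ s + 1) a
    · rw [← eq_sub_iff_add_eq'] at hsum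
      rw [hsum]
      exact sub_mem hx h0
  have h := congrArg (fun y => b.repr y i) hz
  rw [Finset.sum_filter] at h
  simpa [Finset.sum_apply', apply_ite, ite_apply, Finsupp.single_apply, hi] using h

theorem squareForm_mem [Fintype ι] (hb : ∀ i, b i ∈ part (𝕜 := 𝕜) (d i)) (a c : ZMod 2)
    (x y : L) (hx : x ∈ part (𝕜 := 𝕜) a) (hy : y ∈ part (𝕜 := 𝕜) c) :
    squareForm b d x y ∈ squarePart 𝕜 d (a + c) := by
  intro p hp
  have key : ∀ i j, d i + d j ≠ a + c → b.repr x i * b.repr y j = 0 := by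
    intro i j hij
    by_cases hi : d i = a
    · rw [repr_eq_zero_of_mem_part hb hy (i := j) (fun hj => hij (by rw [hi, hj])), mul_zero]
    · rw [repr_eq_zero_of_mem_part hb hx hi, zero_mul]
  rw [squareForm_apply, key _ _ hp, key _ _ (by rwa [add_comm]), mul_zero, sub_zero]

/-- The form's sign uses the degrees of the basis indices, the claim uses those of x and y; they
agree wherever the product of coordinates is nonzero. -/
theorem squareForm_antisymm [Fintype ι] (hb : ∀ i, b i ∈ part (𝕜 := 𝕜) (d i)) (a c : ZMod 2)
    (x y : L) (hx : x ∈ part (𝕜 := 𝕜) a) (hy : y ∈ part (𝕜 := 𝕜) c) :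
    squareForm b d x y = -((-1 : 𝕜) ^ (a.val * c.val) • squareForm b d y x) := by
  have key : ∀ i j, (-1 : 𝕜) ^ ((d i).val * (d j).val) * (b.repr x i * b.repr y j) =
      (-1 : 𝕜) ^ (a.val * c.val) * (b.repr x i * b.repr y j) := by
    intro i j
    by_cases hi : d i = a
    · by_cases hj : d j = c
      · rw [hi, hj]
      · rw [repr_eq_zero_of_mem_part hb hy hj, mul_zero, mul_zero, mul_zero]
    · rw [repr_eq_zero_of_mem_part hb hx hi, zero_mul, mul_zero, mul_zero]
  have hsq : (-1 : 𝕜) ^ (a.val * c.val) * (-1) ^ (a.val * c.val) = 1 := by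
    rw [← mul_pow, neg_one_mul, neg_neg, one_pow]
  funext p
  have k1 := key p.1 p.2
  have k2 := key p.2 p.1
  rw [mul_comm (d p.2).val] at k2
  simp only [squareForm_apply, Pi.neg_apply, Pi.smul_apply, smul_eq_mul]
  linear_combination (-1 : 𝕜) * k2 - (-1 : 𝕜) ^ (a.val * c.val) * k1
    - (b.repr x p.1 * b.repr y p.2) * hsq

end squareForm

/-! ### Independence of the form on the listed pairs -/

section independence

variable {𝕜 L α β : Type*} [Field 𝕜] [AddCommGroup L] [Module 𝕜 L] [LinearOrder α]

/-- Evaluating the values at the listed pairs gives a diagonal matrix: its entries are 1 for i ≠ j,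
and 1 - (-1) = 2 ≠ 0 for an odd (i, i). -/
theorem linearIndependent_squareForm [Fintype α] [Fintype β] (h2 : (2 : 𝕜) ≠ 0)
    (b : Basis (α ⊕ β) 𝕜 L) (d : α ⊕ β → ZMod 2) :
    LinearIndependent 𝕜 fun t : PairIndex β (d ∘ Sum.inl) =>
      squareForm b d (b t.toPair.1) (b t.toPair.2) := by
  classical
  have hval : ∀ (i j : α ⊕ β) (p : (α ⊕ β) × (α ⊕ β)), squareForm b d (b i) (b j) p =
      (if (i, j) = p then 1 else 0)
        - (-1) ^ ((d p.1).val * (d p.2).val) * (if (i, j) = p.swap then 1 else 0) := by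
    intro i j p
    rw [squareForm_apply, b.repr_self, b.repr_self]
    simp only [Finsupp.single_apply, Prod.ext_iff, Prod.fst_swap, Prod.snd_swap, ite_and,
      ite_mul, one_mul, zero_mul]
  have hoff : ∀ t t' : PairIndex β (d ∘ Sum.inl), t ≠ t' →
      squareForm b d (b t.toPair.1) (b t.toPair.2) t'.toPair = 0 := by
    intro t t' h
    rw [hval, if_neg fun e => h (PairIndex.toPair_injective e),
      if_neg fun e => h (PairIndex.toPair_eq_of_eq_swap e).1, mul_zero, sub_zero]
  have hdiag : ∀ t : PairIndex β (d ∘ Sum.inl),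
      squareForm b d (b t.toPair.1) (b t.toPair.2) t.toPair ≠ 0 := by
    intro t
    rw [hval, if_pos rfl]
    split_ifs with h
    · obtain ⟨i, j⟩ | ⟨i, j⟩ := t
      · have hd : d (Sum.inl i.1) = 1 ∧ d (Sum.inl i.2) = 1 := by
          have e : i.1 = i.2 := Sum.inl_injective (congrArg Prod.fst h)
          rcases j with j | ⟨-, j⟩
          · exact absurd e j.ne
          · exact ⟨j, e ▸ j⟩
        have hv : (1 : ZMod 2).val = 1 := rfl
        simp only [PairIndex.toPair, hd.1, hd.2, hv]
        norm_num
        exact h2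
      · exact absurd (congrArg Prod.fst h) Sum.inl_ne_inr
    · simp
  rw [Fintype.linearIndependent_iff]
  intro g hg t
  have h := congrFun hg t.toPair
  rw [Finset.sum_apply, Finset.sum_eq_single t (fun t' _ ht' => by
    rw [Pi.smul_apply, hoff t' t ht', smul_zero]) (by simp), Pi.smul_apply, Pi.zero_apply,
    smul_eq_zero] at h
  exact h.resolve_right (hdiag t)

end independence

/-! ### The dimension of the multiplier -/

section multiplier

variable {𝕜 L : Type*} [Field 𝕜] [AddCommGroup L] [Module 𝕜 L] [Bracket L L]
  [LieSuperalgebra 𝕜 L]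

namespace FreePresentation

variable (P : FreePresentation 𝕜 L) (N : Submodule 𝕜 L)

/-- The multiplier `M(N, L)` is the image of `R ∩ [S, F]` in `F / [R, F]`. -/
noncomputable def schurMultiplierEquiv : P.schurMultiplier N ≃ₗ[𝕜]
    ↥((P.R ⊓ commutator 𝕜 (P.S N) ⊤).map (commutator 𝕜 P.R ⊤).mkQ) :=
  Submodule.quotEquivOfEq _ _ (by
      rw [LinearMap.ker_comp, ker_mkQ]
      rfl) ≪≫ₗ
    ((commutator 𝕜 P.R ⊤).mkQ ∘ₗ (P.R ⊓ commutator 𝕜 (P.S N) ⊤).subtype).quotKerEquivRange ≪≫ₗ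
    LinearEquiv.ofEq _ _ (by rw [LinearMap.range_comp, range_subtype])

theorem commutator_R_le : commutator 𝕜 P.R ⊤ ≤ P.R := by
  refine span_le.2 ?_
  rintro _ ⟨r, hr, y, -, rfl⟩
  have h0 := smul_bracket (0 : 𝕜) (0 : L) (P.π y)
  rw [zero_smul, zero_smul] at h0
  exact (P.isSuperHom.map_bracket r y).trans (by rw [LinearMap.mem_ker.1 hr, h0])

theorem commutator_le_R_of_isAbelian (hL : IsAbelian L) : commutator 𝕜 (P.S N) ⊤ ≤ P.R := by
  refine span_le.2 ?_
  rintro _ ⟨s, -, y, -, rfl⟩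
  exact (P.isSuperHom.map_bracket s y).trans (hL _ _)

theorem le_center_of_commutator_le_R (h : commutator 𝕜 (P.S N) ⊤ ≤ P.R) : N ≤ center 𝕜 L := by
  intro z hz x
  obtain ⟨s, rfl⟩ := P.surjective z
  obtain ⟨y, rfl⟩ := P.surjective x
  rw [← P.isSuperHom.map_bracket]
  exact h (bracket_mem_commutator 𝕜 hz mem_top)

variable {P N} {α β : Type*} [LinearOrder α] [Fintype α] [Fintype β]

/-- Dimension of `M(N, L)` in terms of a homogeneous basis of `L` that extends a basis of `N`. -/
theorem finrank_schurMultiplier (h2 : (2 : 𝕜) ≠ 0) (b : Basis (α ⊕ β) 𝕜 L)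
    (d : α ⊕ β → ZMod 2) (hb : ∀ i, b i ∈ part (𝕜 := 𝕜) (d i))
    (hN : span 𝕜 (Set.range (b ∘ Sum.inl)) = N) :
    FiniteDimensional 𝕜 (P.schurMultiplier N) ∧
    finrank 𝕜 (P.schurMultiplier N) ≤ Fintype.card (PairIndex β (d ∘ Sum.inl)) ∧
    (IsAbelian L →
      finrank 𝕜 (P.schurMultiplier N) = Fintype.card (PairIndex β (d ∘ Sum.inl))) ∧
    (finrank 𝕜 (P.schurMultiplier N) = Fintype.card (PairIndex β (d ∘ Sum.inl)) →
      N ≤ center 𝕜 L) := by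
  choose x hx hxb using fun i =>
    P.isSuperHom.exists_homogeneous_preimage P.surjective (d i) (hb i)
  have hfx : P.π ∘ x = b := funext hxb
  set C := commutator 𝕜 P.R ⊤
  let v := fun t : PairIndex β (d ∘ Sum.inl) => ⁅x t.toPair.1, x t.toPair.2⁆
  have hle : commutator 𝕜 (P.S N) ⊤ ≤ span 𝕜 (Set.range v) ⊔ C :=
    P.isSuperHom.commutator_comap_le h2 hx (by rw [hfx, b.span_eq])
      (by rw [← Function.comp_assoc, hfx, hN])
  have hvmem : ∀ t, v t ∈ commutator 𝕜 (P.S N) ⊤ := by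
    have h : ∀ i, x (Sum.inl i) ∈ P.S N := fun i => by
      refine mem_comap.2 ?_
      rw [hxb, ← hN]
      exact subset_span ⟨i, rfl⟩
    rintro (t | t)
    · exact bracket_mem_commutator 𝕜 (h _) mem_top
    · exact bracket_mem_commutator 𝕜 (h _) mem_top
  have hspan : (commutator 𝕜 (P.S N) ⊤).map C.mkQ = span 𝕜 (Set.range (C.mkQ ∘ v)) := by
    rw [Set.range_comp, ← map_span]
    refine le_antisymm ((map_mono hle).trans ?_) (map_mono (span_le.2 ?_))
    · rw [Submodule.map_sup, mkQ_map_self, sup_bot_eq]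
    · rintro _ ⟨t, rfl⟩
      exact hvmem t
  have hmap : (P.R ⊓ commutator 𝕜 (P.S N) ⊤).map C.mkQ ≤ span 𝕜 (Set.range (C.mkQ ∘ v)) :=
    (map_mono inf_le_right).trans hspan.le
  have hfin : FiniteDimensional 𝕜 (span 𝕜 (Set.range (C.mkQ ∘ v))) :=
    FiniteDimensional.span_of_finite 𝕜 (Set.finite_range _)
  have hfin' := finiteDimensional_of_le hmap
  have hcard : finrank 𝕜 (span 𝕜 (Set.range (C.mkQ ∘ v))) ≤
      Fintype.card (PairIndex β (d ∘ Sum.inl)) := finrank_range_le_card _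
  have hrank := (P.schurMultiplierEquiv N).finrank_eq
  refine ⟨(P.schurMultiplierEquiv N).symm.finiteDimensional, ?_, fun hL => ?_, fun h => ?_⟩
  · rw [hrank]
    exact (finrank_mono hmap).trans hcard
  · obtain ⟨Φ, hΦ⟩ := P.exists_linearMap_bracket hL (squareForm b d) (isCompl_squarePart d)
      (squareForm_mem hb) (squareForm_antisymm hb)
    -- Φ of a bracket depends only on the images under π, and π kills R; so Φ descends to `F / [R,
    -- F]`.
    have hC : C ≤ LinearMap.ker Φ := by
      refine span_le.2 ?_
      rintro _ ⟨r, hr, y, -, rfl⟩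
      exact (hΦ r y).trans (by rw [LinearMap.mem_ker.1 hr, map_zero, LinearMap.zero_apply])
    have hli : LinearIndependent 𝕜 (C.mkQ ∘ v) := by
      refine LinearIndependent.of_comp (C.liftQ Φ hC) ?_
      have e : C.liftQ Φ hC ∘ C.mkQ ∘ v = fun t : PairIndex β (d ∘ Sum.inl) =>
          squareForm b d (b t.toPair.1) (b t.toPair.2) := by
        funext t
        simp [v, hΦ, hxb]
      rw [e]
      exact linearIndependent_squareForm h2 b d
    rw [hrank, inf_eq_right.2 (P.commutator_le_R_of_isAbelian N hL), hspan,
      finrank_span_eq_card hli]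
  · refine P.le_center_of_commutator_le_R N fun z hz => ?_
    -- The multiplier attains the number of spanning vectors, so its image fills all of `[S, F]`
    -- modulo `[R, F]`.
    have heq := eq_of_le_of_finrank_le hmap (by rw [← hrank, h]; exact hcard)
    have hz' : C.mkQ z ∈ (P.R ⊓ commutator 𝕜 (P.S N) ⊤).map C.mkQ := by
      rw [heq, ← hspan]
      exact mem_map_of_mem hz
    obtain ⟨y, hy, e⟩ := hz'
    -- z differs from y ∈ R by an element of `[R, F] ⊆ R`, so z ∈ R.
    have hyz : y - z ∈ P.R := P.commutator_R_le ((Submodule.Quotient.eq C).1 e)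
    simpa using sub_mem hy.1 hyz

end FreePresentation

end multiplier

end LieSuper

/-! ### The main theorem -/

theorem theorem3p4 {𝕜 : Type*} [Field 𝕜] [IsAlgClosed 𝕜] (h2 : ringChar 𝕜 ≠ 2)
    (h3 : ringChar 𝕜 ≠ 3) {L : Type*} [AddCommGroup L] [Module 𝕜 L] [Bracket L L]
    [LieSuper.LieSuperalgebra 𝕜 L] [FiniteDimensional 𝕜 L]
    (N : Submodule 𝕜 L) (hN : LieSuper.IsGradedIdeal 𝕜 N) (m n : ℕ)
    (hm : Module.finrank 𝕜 ↥(N ⊓ LieSuper.LieSuperalgebra.part 0) = m)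
    (hn : Module.finrank 𝕜 ↥(N ⊓ LieSuper.LieSuperalgebra.part 1) = n)
    (P : LieSuper.FreePresentation 𝕜 L) :
    FiniteDimensional 𝕜 (P.schurMultiplier N) ∧
    (Module.finrank 𝕜 (P.schurMultiplier N) : ℚ) ≤
      (1 / 2 : ℚ) * (((m : ℚ) + n) ^ 2 + ((n : ℚ) - m))
        + (Module.finrank 𝕜 N : ℚ) * (Module.finrank 𝕜 (L ⧸ N) : ℚ) ∧
    (LieSuper.IsAbelian L →
      (Module.finrank 𝕜 (P.schurMultiplier N) : ℚ) =
        (1 / 2 : ℚ) * (((m : ℚ) + n) ^ 2 + ((n : ℚ) - m))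
          + (Module.finrank 𝕜 N : ℚ) * (Module.finrank 𝕜 (L ⧸ N) : ℚ)) ∧
    ((Module.finrank 𝕜 (P.schurMultiplier N) : ℚ) =
        (1 / 2 : ℚ) * (((m : ℚ) + n) ^ 2 + ((n : ℚ) - m))
          + (Module.finrank 𝕜 N : ℚ) * (Module.finrank 𝕜 (L ⧸ N) : ℚ) →
      N ≤ LieSuper.center 𝕜 L) := by
  obtain ⟨p, k, b, d, hp, hb, hbN, hodd⟩ := LieSuper.exists_adapted_basis hN.graded
  rw [hm, hn] at hp
  rw [hn] at hodd
  have hNp : Module.finrank 𝕜 N = p := by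
    rw [← hbN, finrank_span_eq_card (b.linearIndependent.comp _ Sum.inl_injective),
      Fintype.card_fin]
  have hLN : Module.finrank 𝕜 (L ⧸ N) = k := by
    have e1 := Submodule.finrank_quotient_add_finrank N
    have e2 := Module.finrank_eq_card_basis b
    rw [Fintype.card_sum, Fintype.card_fin, Fintype.card_fin] at e2
    omega
  have hcard := LieSuper.PairIndex.two_mul_card (β := Fin k) (d ∘ Sum.inl)
  simp only [Function.comp_apply] at hcard
  rw [hodd, Fintype.card_fin, Fintype.card_fin] at hcard
  -- With p = m + n and n odd indices, p² - p + 2n = (m + n)² + (n - m), so halving the count gives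
  -- the bound.
  have hbound : (1 / 2 : ℚ) * (((m : ℚ) + n) ^ 2 + ((n : ℚ) - m))
      + (Module.finrank 𝕜 N : ℚ) * (Module.finrank 𝕜 (L ⧸ N) : ℚ)
      = (Fintype.card (LieSuper.PairIndex (Fin k) (d ∘ Sum.inl)) : ℚ) := by
    rw [hNp, hLN]
    have hc := congrArg (Nat.cast : ℕ → ℚ) hcard
    have hp' := congrArg (Nat.cast : ℕ → ℚ) hp
    push_cast at hc hp'
    rw [hp'] at hc ⊢
    linear_combination (-1 / 2 : ℚ) * hc
  rw [hbound]
  obtain ⟨t1, t2, t3, t4⟩ := LieSuper.FreePresentation.finrank_schurMultiplier (P := P)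
    (Ring.two_ne_zero h2) b d hb hbN
  exact ⟨t1, Nat.cast_le.2 t2, fun h => Nat.cast_inj.2 (t3 h), fun h => t4 (Nat.cast_inj.1 h)⟩
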